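/- Let $a\in\mathbb R$ and let $M:\mathbb R\to\mathbb R$ be a $C^2$ function. Consider the Kerr-Vaidya metric in ingoing coordinates $(v,r,\vartheta,\psi)\in\mathbb R\times\mathbb R_+\times(0,\pi)\times(0,2\pi)$, $$ds^2=-\Big(1-\frac{2M(v)r}{\rho^2}\Big)dv^2+2\,dv\,dr-\frac{4M(v)ar\sin^2\vartheta}{\rho^2}\,dv\,d\psi-2a\sin^2\vartheta\,dr\,d\psi+\rho^2d\vartheta^2+\frac{(r^2+a^2)^2-\Delta a^2\sin^2\vartheta}{\rho^2}\sin^2\vartheta\,d\psi^2,$$ where $\rho^2=r^2+a^2\cos^2\vartheta$ and $\Delta=r^2-2M(v)r+a^2$. Let $G^{ab}$ be its Einstein tensor, $K^a=(\partial/\partial v)^a$ the Kodama-like vector field, $J^a=G^{ab}K_b$ the associated current, and $n_a=(dr)_a$. The Noether charge at radius $r>0$ and advanced time $v$ is $$Q_K(r,v)=\frac1{8\pi}\int_{\Sigma_r,\ \underline v\le v}J^an_a\,d\mathrm{vol}_{\Sigma_r},\qquad d\mathrm{vol}_{\Sigma_r}=\sqrt{-g}\;d\underline v\,d\vartheta\,d\psi,$$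 the integral over the part up to advanced time $v$ of the hypersurface $\Sigma_r$ of constant $r$. Assume $\lim_{\underline v\to-\infty}M(\underline v)=0$ and that $M'$ and $M''$ are integrable on $(-\infty,v]$. Then for every $r>0$ the integral defining $Q_K(r,v)$ converges absolutely, and $$Q_K(r,v)=M(v)-M'(v)\left(\frac{r^2+a^2}{2a}\arctan\Big(\frac ar\Big)-\frac r2\right)\quad\text{if } a\ne0,\qquad Q_K(r,v)=M(v)\quad\text{if } a=0.$$ In particular, $\lim_{r\to\infty}Q_K(r,v)=M(v)$ for every $a\in\mathbb R$. -/

import Mathlib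

open Real Set Filter Topology MeasureTheory

noncomputable section

namespace KerrVaidya

/-- Coordinate 4-tuples; for the Kerr-Vaidya metric the coordinates are
`(v, r, ϑ, ψ) = (x 0, x 1, x 2, x 3)`. -/
abbrev Coord : Type := Fin 4 → ℝ

/-- The partial derivative `∂_μ f` at `x`. -/
def pd (μ : Fin 4) (f : Coord → ℝ) (x : Coord) : ℝ :=
  deriv (fun t : ℝ => f (Function.update x μ t)) (x μ)

section Curvature

/-- Christoffel symbols `Γ^α_{βγ} = ½ g^{αδ} (∂_β g_{δγ} + ∂_γ g_{δβ} - ∂_δ g_{βγ})` of the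
Levi-Civita connection of the metric with components `g`. -/
def christoffel (g : Coord → Matrix (Fin 4) (Fin 4) ℝ) (α β γ : Fin 4) (x : Coord) : ℝ :=
  (1 / 2) * ∑ δ, (g x)⁻¹ α δ *
    (pd β (fun y => g y δ γ) x + pd γ (fun y => g y δ β) x - pd δ (fun y => g y β γ) x)

/-- Ricci tensor
`R_{βγ} = ∂_α Γ^α_{βγ} - ∂_γ Γ^α_{βα} + Γ^α_{αδ} Γ^δ_{βγ} - Γ^α_{γδ} Γ^δ_{βα}`. -/
def ricci (g : Coord → Matrix (Fin 4) (Fin 4) ℝ) (β γ : Fin 4) (x : Coord) : ℝ :=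
  ∑ α, (pd α (christoffel g α β γ) x - pd γ (christoffel g α β α) x)
    + ∑ α, ∑ δ, (christoffel g α α δ x * christoffel g δ β γ x
        - christoffel g α γ δ x * christoffel g δ β α x)

/-- Ricci scalar `R = g^{αβ} R_{αβ}`. -/
def ricciScalar (g : Coord → Matrix (Fin 4) (Fin 4) ℝ) (x : Coord) : ℝ :=
  ∑ α, ∑ β, (g x)⁻¹ α β * ricci g α β x

/-- Einstein tensor `G_{αβ} = R_{αβ} - ½ R g_{αβ}`. -/
def einstein (g : Coord → Matrix (Fin 4) (Fin 4) ℝ) (α β : Fin 4) (x : Coord) : ℝ :=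
  ricci g α β x - (1 / 2) * ricciScalar g x * g x α β

/-- Einstein tensor with raised indices, `G^{αβ} = g^{αγ} g^{βδ} G_{γδ}`. -/
def einsteinUp (g : Coord → Matrix (Fin 4) (Fin 4) ℝ) (α β : Fin 4) (x : Coord) : ℝ :=
  ∑ γ, ∑ δ, (g x)⁻¹ α γ * (g x)⁻¹ β δ * einstein g γ δ x

/-- The current `G^{αβ} X_β`, with `X_β = g_{βγ} X^γ`, generated by a vector field `X`. -/
def current (g : Coord → Matrix (Fin 4) (Fin 4) ℝ) (X : Coord → Fin 4 → ℝ)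
    (α : Fin 4) (x : Coord) : ℝ :=
  ∑ β, einsteinUp g α β x * ∑ γ, g x β γ * X x γ

end Curvature

/-- `ρ² = r² + a² cos² ϑ`. -/
def rhoSq (a : ℝ) (x : Coord) : ℝ := x 1 ^ 2 + a ^ 2 * cos (x 2) ^ 2

/-- `Δ = r² - 2 M(v) r + a²`. -/
def Delta (a : ℝ) (M : ℝ → ℝ) (x : Coord) : ℝ := x 1 ^ 2 - 2 * M (x 0) * x 1 + a ^ 2

/-- `Γ = r² + a²`. -/
def Gam (a : ℝ) (x : Coord) : ℝ := x 1 ^ 2 + a ^ 2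

/-- Components of the Kerr-Vaidya metric in ingoing coordinates `(v, r, ϑ, ψ)`. -/
def metric (a : ℝ) (M : ℝ → ℝ) (x : Coord) : Matrix (Fin 4) (Fin 4) ℝ :=
  !![-(1 - 2 * M (x 0) * x 1 / rhoSq a x), 1, 0,
        -(2 * M (x 0) * a * x 1 * sin (x 2) ^ 2 / rhoSq a x);
     1, 0, 0, -(a * sin (x 2) ^ 2);
     0, 0, rhoSq a x, 0;
     -(2 * M (x 0) * a * x 1 * sin (x 2) ^ 2 / rhoSq a x), -(a * sin (x 2) ^ 2), 0,
        (Gam a x ^ 2 - Delta a M x * a ^ 2 * sin (x 2) ^ 2) / rhoSq a x * sin (x 2) ^ 2]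

/-- The Kodama-like vector field `K = ∂/∂v`. -/
def kodamaField (_x : Coord) : Fin 4 → ℝ := ![1, 0, 0, 0]

/-- The normal co-vector `n = dr` of the hypersurfaces of constant `r`. -/
def normalCovector (_x : Coord) : Fin 4 → ℝ := ![0, 1, 0, 0]

/-- The point of `Σ_r` with coordinates `p = (v, ϑ, ψ)`. -/
def embed (r : ℝ) (p : ℝ × ℝ × ℝ) : Coord := ![p.1, r, p.2.1, p.2.2]

/-- The part of `Σ_r` up to advanced time `v`, in the coordinates `(v, ϑ, ψ)`. -/
def sigma (v : ℝ) : Set (ℝ × ℝ × ℝ) := Iic v ×ˢ (Ioo 0 π ×ˢ Ioo 0 (2 * π))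

/-- The integrand `J^a n_a √(-g)` on `Σ_r`, where `J` is the current of the Kodama-like field.
The volume form of `Σ_r` belonging to the normal co-vector `n = dr` is `√(-g) dv dϑ dψ`, that is,
the one whose product with `dr` is the volume form of spacetime. -/
def chargeDensity (a : ℝ) (M : ℝ → ℝ) (r : ℝ) (p : ℝ × ℝ × ℝ) : ℝ :=
  (∑ α, current (metric a M) kodamaField α (embed r p) * normalCovector (embed r p) α)
    * √(-(metric a M (embed r p)).det)

/-- The Noether charge `Q_K = (8π)⁻¹ ∫_{Σ_r} J^a n_a dvol`, at radius `r` and advanced time `v`. -/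
def charge (a : ℝ) (M : ℝ → ℝ) (r v : ℝ) : ℝ :=
  1 / (8 * π) * ∫ p in sigma v, chargeDensity a M r p

end KerrVaidya

end

/-! The radial current is the mixed component $G^r{}_v$. Since $\delta^r_v=0$, the scalar curvature
drops out and $J^r=g^{r\gamma}R_{\gamma v}$ (`current_kodamaField`), so only $R_{vv}$, $R_{rv}=0$
and $R_{\psi v}$ are needed. Multiplied by $\sqrt{-g}=\rho^2\sin\vartheta$, the current becomes
$M'(v)$ times one function of $\vartheta$ minus $M''(v)$ times another (`chargeDensity_eq`).

The variables therefore separate. The first profile integrates to 4 whatever $a$ and $r$ are, which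
gives $M(v)$; the second gives the arctangent (`integral_massProfile`, `integral_fluxProfile`) and
is $O(a^2/r)$, hence the limit. Integrability of $M'$ and $M''$ forces $M'\to0$ at $-\infty$, so
$M''$ integrates to $M'(v)$ (`charge_eq`). -/

namespace KerrVaidya

/-! ### Inverse metric and Levi-Civita connection -/

/-- The inverse of the Kerr-Vaidya metric. -/
noncomputable def inverseMetric (a : ℝ) (M : ℝ → ℝ) (x : Coord) : Matrix (Fin 4) (Fin 4) ℝ :=
  !![a ^ 2 * sin (x 2) ^ 2 / rhoSq a x, Gam a x / rhoSq a x, 0, a / rhoSq a x;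
     Gam a x / rhoSq a x, Delta a M x / rhoSq a x, 0, a / rhoSq a x;
     0, 0, 1 / rhoSq a x, 0;
     a / rhoSq a x, a / rhoSq a x, 0, 1 / (rhoSq a x * sin (x 2) ^ 2)]

/-- The partial derivatives of the components of the Kerr-Vaidya metric. -/
noncomputable def metricDeriv (a : ℝ) (M : ℝ → ℝ) (x : Coord) :
    Fin 4 → Matrix (Fin 4) (Fin 4) ℝ
  | 0 =>
    -- Kerr-Schild form: $M$ enters the metric only through $(2Mr/\rho^2)\,\ell\otimes\ell$ with
    -- $\ell=dv-a\sin^2\vartheta\,d\psi$. Here `f` is the $v$-derivative of $2Mr/\rho^2$.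
    let f := 2 * deriv M (x 0) * x 1 / rhoSq a x
    !![f, 0, 0, -(a * sin (x 2) ^ 2 * f);
       0, 0, 0, 0;
       0, 0, 0, 0;
       -(a * sin (x 2) ^ 2 * f), 0, 0, a ^ 2 * sin (x 2) ^ 4 * f]
  | 1 =>
    let f := 2 * M (x 0) * (a ^ 2 * cos (x 2) ^ 2 - x 1 ^ 2) / rhoSq a x ^ 2
    !![f, 0, 0, -(a * sin (x 2) ^ 2 * f);
       0, 0, 0, 0;
       0, 0, 2 * x 1, 0;
       -(a * sin (x 2) ^ 2 * f), 0, 0, sin (x 2) ^ 2 * (2 * x 1 + a ^ 2 * sin (x 2) ^ 2 * f)]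
  | 2 =>
    let f := 2 * M (x 0) * x 1 / rhoSq a x
    let f' := 4 * M (x 0) * x 1 * a ^ 2 * cos (x 2) * sin (x 2) / rhoSq a x ^ 2
    let h := 2 * sin (x 2) * cos (x 2)
    !![f', 0, 0, -(a * (h * f + sin (x 2) ^ 2 * f'));
       0, 0, 0, -(a * h);
       0, 0, -(a ^ 2 * h), 0;
       -(a * (h * f + sin (x 2) ^ 2 * f')), -(a * h), 0,
       h * (Gam a x + a ^ 2 * sin (x 2) ^ 2 * f)
         + sin (x 2) ^ 2 * (a ^ 2 * h * f + a ^ 2 * sin (x 2) ^ 2 * f')]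
  | 3 => 0

/-- The Christoffel symbols of the Kerr-Vaidya metric. -/
noncomputable def connection (a : ℝ) (M : ℝ → ℝ) (x : Coord) :
    Fin 4 → Matrix (Fin 4) (Fin 4) ℝ :=
  let r := x 1
  let s := sin (x 2)
  let c := cos (x 2)
  let R := rhoSq a x
  let G := Gam a x
  let D := Delta a M x
  -- With $F=2Mr/\rho^2$: $p=-\partial_rF/(2\rho^2)$, $q=\partial_vF/(2\rho^2)$ and
  -- $a^2w=\tfrac12\partial_\vartheta F$.
  let p := M (x 0) * (r ^ 2 - a ^ 2 * c ^ 2) / R ^ 3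
  let q := deriv M (x 0) * r / R ^ 2
  let w := 2 * M (x 0) * r * c * s / R ^ 2
  fun
  | 0 =>
    let k := G * p - a ^ 2 * s ^ 2 * q
    !![k, 0, -(a ^ 2 * w), -(a * s ^ 2 * k);
       0, 0, -(a ^ 2 * c * s / R), r * a * s ^ 2 / R;
       -(a ^ 2 * w), -(a ^ 2 * c * s / R), -(r * G / R), a ^ 3 * s ^ 2 * w;
       -(a * s ^ 2 * k), r * a * s ^ 2 / R, a ^ 3 * s ^ 2 * w,
       a ^ 2 * s ^ 4 * k - r * s ^ 2 * G / R]
  | 1 =>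
    !![D * p + (R - a ^ 2 * s ^ 2) * q, -(R * p), 0, -(a * s ^ 2 * (D * p - a ^ 2 * s ^ 2 * q));
       -(R * p), 0, -(a ^ 2 * c * s / R), a * s ^ 2 * (r / R + R * p);
       0, -(a ^ 2 * c * s / R), -(r * D / R), 0;
       -(a * s ^ 2 * (D * p - a ^ 2 * s ^ 2 * q)), a * s ^ 2 * (r / R + R * p), 0,
       a ^ 2 * s ^ 4 * (D * p - G * q) - r * s ^ 2 * D / R]
  | 2 =>
    !![-(a ^ 2 * w / R), 0, 0, a * G * w / R;
       0, 0, r / R, a * c * s / R;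
       0, r / R, -(a ^ 2 * c * s / R), 0;
       a * G * w / R, a * c * s / R, 0,
       -(c * s * G / R) - a ^ 2 * s ^ 2 * w * (2 + a ^ 2 * s ^ 2 / R)]
  | 3 =>
    let k := a * (p - q)
    let w' := 2 * M (x 0) * r * a * c / (s * R ^ 2)
    !![k, 0, -w', -(a * s ^ 2 * k);
       0, 0, -(a * c / (s * R)), r / R;
       -w', -(a * c / (s * R)), -(r * a / R), c / s + a ^ 2 * w;
       -(a * s ^ 2 * k), r / R, c / s + a ^ 2 * w, a ^ 2 * s ^ 4 * k - r * a * s ^ 2 / R]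

theorem rhoSq_ne_zero {a : ℝ} {x : Coord} (hr : 0 < x 1) : rhoSq a x ≠ 0 := by
  unfold rhoSq; positivity

theorem metric_mul_inverseMetric {a : ℝ} {M : ℝ → ℝ} {x : Coord} (hr : 0 < x 1)
    (hs : sin (x 2) ≠ 0) : metric a M x * inverseMetric a M x = 1 := by
  have hR := rhoSq_ne_zero (a := a) hr
  ext i j
  fin_cases i <;> fin_cases j <;>
    simp [Matrix.mul_apply, Fin.sum_univ_four, metric, inverseMetric] <;>
    field_simp <;> simp only [rhoSq, Gam, Delta, cos_sq'] <;> ring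

theorem inv_metric {a : ℝ} {M : ℝ → ℝ} {x : Coord} (hr : 0 < x 1)
    (hs : sin (x 2) ≠ 0) : (metric a M x)⁻¹ = inverseMetric a M x :=
  Matrix.inv_eq_right_inv (metric_mul_inverseMetric hr hs)

theorem det_metric {a : ℝ} {M : ℝ → ℝ} {x : Coord} (hr : 0 < x 1) :
    (metric a M x).det = -(rhoSq a x * sin (x 2)) ^ 2 := by
  have hR := rhoSq_ne_zero (a := a) hr
  simp [Matrix.det_succ_row_zero, Fin.sum_univ_succ, metric, Fin.succAbove]
  field_simp
  simp only [rhoSq, Gam, Delta, cos_sq']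
  ring

theorem hasDerivAt_radial (b r : ℝ) : HasDerivAt (fun t : ℝ => t ^ 2 + b) (2 * r) r := by
  simpa using (hasDerivAt_pow 2 r).add_const b

theorem hasDerivAt_polar (a b θ : ℝ) :
    HasDerivAt (fun t : ℝ => b + a ^ 2 * cos t ^ 2) (-(2 * a ^ 2 * cos θ * sin θ)) θ := by
  refine ((((hasDerivAt_cos θ).pow 2).const_mul (a ^ 2)).const_add b).congr_deriv ?_
  simp only [Nat.cast_ofNat, Nat.add_one_sub_one, pow_one]
  ring

theorem hasDerivAt_sin_sq (θ : ℝ) : HasDerivAt (fun t => sin t ^ 2) (2 * sin θ * cos θ) θ := by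
  simpa [Pi.pow_def] using (hasDerivAt_sin θ).pow 2

/-- No regularity of $M$ is needed: each entry is affine in $M(v)$ with coefficients free of $v$,
and `deriv` respects such combinations unconditionally. -/
theorem pd_metric {a : ℝ} {M : ℝ → ℝ} {x : Coord} (hr : 0 < x 1)
    (μ i j : Fin 4) : pd μ (fun y => metric a M y i j) x = metricDeriv a M x μ i j := by
  have hR : x 1 ^ 2 + a ^ 2 * cos (x 2) ^ 2 ≠ 0 := rhoSq_ne_zero (a := a) hr
  have hR' := hasDerivAt_radial (a ^ 2 * cos (x 2) ^ 2) (x 1)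
  have hG := hasDerivAt_radial (a ^ 2) (x 1)
  have hT := hasDerivAt_polar a (x 1 ^ 2) (x 2)
  have hS := hasDerivAt_sin_sq (x 2)
  have h1 (k : ℝ) : HasDerivAt (fun t => k * t) k (x 1) := by
    simpa using (hasDerivAt_id (x 1)).const_mul k
  have hD : HasDerivAt (fun t => t ^ 2 - 2 * M (x 0) * t + a ^ 2) (2 * x 1 - 2 * M (x 0)) (x 1) := by
    simpa using ((hasDerivAt_pow 2 (x 1)).sub (h1 (2 * M (x 0)))).add_const (a ^ 2)
  have r00 := ((h1 (2 * M (x 0))).div hR' hR).deriv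
  have r03 := (((h1 (2 * M (x 0) * a)).mul_const (sin (x 2) ^ 2)).div hR' hR).deriv
  have r33 := (((hG.pow 2).sub ((hD.mul_const (a ^ 2)).mul_const (sin (x 2) ^ 2))).div hR' hR).deriv
  have t00 := ((hasDerivAt_const (x 2) (2 * M (x 0) * x 1)).div hT hR).deriv
  have t03 := ((hS.const_mul (2 * M (x 0) * a * x 1)).div hT hR).deriv
  have t33 := ((((hS.const_mul (Delta a M x * a ^ 2)).const_sub (Gam a x ^ 2)).div hT hR).mul hS).deriv
  simp only [Delta, Gam] at t33
  simp only [Pi.div_def, Pi.mul_def, Pi.pow_def, Pi.sub_def] at r00 r03 r33 t00 t03 t33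
  fin_cases μ <;> fin_cases i <;> fin_cases j <;>
    simp only [Fin.zero_eta, Fin.mk_one, Fin.reduceFinMk, metricDeriv, metric, Matrix.of_apply,
      Matrix.cons_val, Matrix.zero_apply]
  all_goals simp [pd, rhoSq, Gam, Delta]
  all_goals first
    | ring1
    | exact Or.inl (by ring1)
    | rw [r00]; field
    | rw [r03]; field
    | rw [t00]; field
    | rw [t03]; field
    | rw [r33]; field_simp; simp only [cos_sq']; push_cast; ring1
    | rw [t33]; field_simp; simp only [cos_sq']; ring1

theorem christoffel_metric {a : ℝ} {M : ℝ → ℝ} {x : Coord}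
    (hr : 0 < x 1) (hs : sin (x 2) ≠ 0) (α β γ : Fin 4) :
    christoffel (metric a M) α β γ x = connection a M x α β γ := by
  have hR := rhoSq_ne_zero (a := a) hr
  simp only [christoffel, pd_metric hr, inv_metric hr hs, Fin.sum_univ_four]
  fin_cases α <;> fin_cases β <;> fin_cases γ <;>
    simp only [Fin.zero_eta, Fin.mk_one, Fin.reduceFinMk, inverseMetric, metricDeriv, connection,
      Matrix.of_apply, Matrix.cons_val, Matrix.zero_apply, zero_mul, mul_zero, add_zero, zero_add,
      sub_zero, zero_sub] <;>
    field_simp <;>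
    try simp only [rhoSq, Gam, Delta, cos_sq']
  all_goals ring1

/-! ### Reduction of the current to the Ricci tensor -/

theorem current_eq_sum (g : Coord → Matrix (Fin 4) (Fin 4) ℝ) (X : Coord → Fin 4 → ℝ) {x : Coord}
    (hg : (g x).IsSymm) (hdet : IsUnit (g x).det) (α : Fin 4) :
    current g X α x = ∑ γ, ∑ δ, (g x)⁻¹ α γ * einstein g γ δ x * X x δ := by
  have h1 : (g x)⁻¹.transpose = (g x)⁻¹ := by rw [Matrix.transpose_nonsing_inv, hg.eq]
  have h2 : ∀ δ ε, ∑ β, (g x)⁻¹ β δ * g x β ε = if δ = ε then 1 else 0 := fun δ ε => by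
    have := congrFun₂ (Matrix.nonsing_inv_mul (g x) hdet) δ ε
    rw [Matrix.mul_apply, ← h1, Matrix.one_apply] at this
    exact this
  calc current g X α x
      = ∑ γ, ∑ δ, (g x)⁻¹ α γ * einstein g γ δ x * ∑ ε, (∑ β, (g x)⁻¹ β δ * g x β ε) * X x ε := by
        simp only [current, einsteinUp, Fin.sum_univ_four]; ring
    _ = _ := by simp [h2]

theorem isSymm_metric (a : ℝ) (M : ℝ → ℝ) (x : Coord) : (metric a M x).IsSymm := by
  ext i j
  fin_cases i <;> fin_cases j <;> rfl

theorem isUnit_det_metric {a : ℝ} {M : ℝ → ℝ} {x : Coord} (hr : 0 < x 1) (hs : sin (x 2) ≠ 0) :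
    IsUnit (metric a M x).det := by
  rw [det_metric hr]
  exact (neg_ne_zero.2 (pow_ne_zero _ (mul_ne_zero (rhoSq_ne_zero hr) hs))).isUnit

theorem current_kodamaField {a : ℝ} {M : ℝ → ℝ} {x : Coord} (hr : 0 < x 1) (hs : sin (x 2) ≠ 0) :
    current (metric a M) kodamaField 1 x =
      ∑ γ, inverseMetric a M x 1 γ * ricci (metric a M) γ 0 x := by
  have h := congrFun₂ (Matrix.nonsing_inv_mul _ (isUnit_det_metric (a := a) (M := M) hr hs)) 1 0
  rw [Matrix.mul_apply, inv_metric hr hs, Matrix.one_apply_ne (by decide), Fin.sum_univ_four] at h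
  rw [current_eq_sum _ _ (isSymm_metric a M x) (isUnit_det_metric hr hs), inv_metric hr hs]
  simp only [Fin.sum_univ_four, kodamaField, einstein, Matrix.cons_val]
  linear_combination -(1 / 2) * ricciScalar (metric a M) x * h

/-! ### Derivatives of the connection and Ricci components -/

/-- The closed form is known only for $r>0$, $\sin\vartheta\ne0$; these conditions are open, so it
may be differentiated. -/
theorem pd_christoffel {a : ℝ} {M : ℝ → ℝ} {x : Coord} (hr : 0 < x 1) (hs : sin (x 2) ≠ 0)
    (μ α β γ : Fin 4) : pd μ (christoffel (metric a M) α β γ) x =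
      pd μ (fun y => connection a M y α β γ) x := by
  refine Filter.EventuallyEq.deriv_eq ?_
  have hc : ContinuousAt (fun t => Function.update x μ t) (x μ) := by fun_prop
  have h1 : ∀ᶠ t in 𝓝 (x μ), 0 < Function.update x μ t 1 :=
    ((continuous_apply 1).continuousAt.comp hc).eventually_const_lt (by simpa using hr)
  have h2 : ∀ᶠ t in 𝓝 (x μ), sin (Function.update x μ t 2) ≠ 0 :=
    (continuous_sin.continuousAt.comp ((continuous_apply 2).continuousAt.comp hc)).eventually_ne
      (by simpa using hs)
  filter_upwards [h1, h2] with t ht1 ht2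
  exact christoffel_metric ht1 ht2 α β γ

theorem pd_zero_connection {a : ℝ} {M : ℝ → ℝ} (hM : ContDiff ℝ 2 M) (x : Coord) :
    let r := x 1
    let s := sin (x 2)
    let R := rhoSq a x
    let p := deriv M (x 0) * (r ^ 2 - a ^ 2 * cos (x 2) ^ 2) / R ^ 3
    let q := deriv (deriv M) (x 0) * r / R ^ 2
    pd 0 (fun y => connection a M y 1 0 1) x = -(R * p) ∧
    pd 0 (fun y => connection a M y 3 0 3) x = -(a * s ^ 2 * (a * (p - q))) ∧
    pd 0 (fun y => connection a M y 1 3 1) x = a * s ^ 2 * (R * p) ∧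
    pd 0 (fun y => connection a M y 3 3 3) x = a ^ 2 * s ^ 4 * (a * (p - q)) := by
  intro r s R p q
  have hM1 : HasDerivAt M (deriv M (x 0)) (x 0) := (hM.differentiable (by norm_num) _).hasDerivAt
  have hM2 : HasDerivAt (deriv M) (deriv (deriv M) (x 0)) (x 0) :=
    (((contDiff_succ_iff_deriv (n := 1)).1 hM).2.2.differentiable (by norm_num) _).hasDerivAt
  have hp : HasDerivAt (fun t => M t * (r ^ 2 - a ^ 2 * cos (x 2) ^ 2) / R ^ 3) p (x 0) :=
    (hM1.mul_const _).div_const _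
  have hq : HasDerivAt (fun t => deriv M t * r / R ^ 2) q (x 0) := (hM2.mul_const _).div_const _
  have hk := (hp.sub hq).const_mul a
  exact ⟨(hp.const_mul R).neg.deriv, (hk.const_mul (a * s ^ 2)).neg.deriv,
    (((hp.const_mul R).const_add (r / R)).const_mul (a * s ^ 2)).deriv,
    ((hk.const_mul (a ^ 2 * s ^ 4)).sub_const (r * a * s ^ 2 / R)).deriv⟩

theorem pd_one_connection {a : ℝ} {M : ℝ → ℝ} {x : Coord} (hr : 0 < x 1) :
    let r := x 1
    let s := sin (x 2)
    let c := cos (x 2)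
    let R := rhoSq a x
    let D := Delta a M x
    let D' := 2 * r - 2 * M (x 0)
    let p := M (x 0) * (r ^ 2 - a ^ 2 * c ^ 2) / R ^ 3
    let p' := M (x 0) * (12 * r * a ^ 2 * c ^ 2 - 4 * r * R) / R ^ 4
    let q := deriv M (x 0) * r / R ^ 2
    let q' := deriv M (x 0) * (R - 4 * r ^ 2) / R ^ 3
    pd 1 (fun y => connection a M y 1 0 0) x =
      D' * p + D * p' + (2 * r * q + (R - a ^ 2 * s ^ 2) * q') ∧
    pd 1 (fun y => connection a M y 1 1 0) x = -(2 * r * p + R * p') ∧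
    pd 1 (fun y => connection a M y 1 3 0) x =
      -(a * s ^ 2 * (D' * p + D * p' - a ^ 2 * s ^ 2 * q')) := by
  intro r s c R D D' p p' q q'
  have hR0 : R ≠ 0 := rhoSq_ne_zero hr
  have hR : HasDerivAt (fun t => t ^ 2 + a ^ 2 * c ^ 2) (2 * r) r := hasDerivAt_radial _ _
  have hD : HasDerivAt (fun t => t ^ 2 - 2 * M (x 0) * t + a ^ 2) D' r := by
    simpa using ((hasDerivAt_pow 2 r).sub ((hasDerivAt_id r).const_mul (2 * M (x 0)))).add_const
      (a ^ 2)
  have hp : HasDerivAt (fun t => M (x 0) * (t ^ 2 - a ^ 2 * c ^ 2) / (t ^ 2 + a ^ 2 * c ^ 2) ^ 3)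
      p' r := by
    refine ((((hasDerivAt_pow 2 r).sub_const (a ^ 2 * c ^ 2)).const_mul (M (x 0))).div (hR.pow 3)
      (pow_ne_zero 3 hR0)).congr_deriv ?_
    change _ / (R ^ 3) ^ 2 = _
    simp only [p', Pi.pow_apply, show r ^ 2 + a ^ 2 * c ^ 2 = R from rfl]
    field_simp
    simp only [R, rhoSq, r, c]
    push_cast
    ring
  have hq : HasDerivAt (fun t => deriv M (x 0) * t / (t ^ 2 + a ^ 2 * c ^ 2) ^ 2) q' r := by
    refine (((hasDerivAt_id r).const_mul (deriv M (x 0))).div (hR.pow 2)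
      (pow_ne_zero 2 hR0)).congr_deriv ?_
    change _ / (R ^ 2) ^ 2 = _
    simp only [q', id, Pi.pow_apply, show r ^ 2 + a ^ 2 * c ^ 2 = R from rfl]
    field_simp
    push_cast
    ring
  exact ⟨((hD.mul hp).add ((hR.sub_const (a ^ 2 * s ^ 2)).mul hq)).deriv, (hR.mul hp).neg.deriv,
    (((hD.mul hp).sub (hq.const_mul (a ^ 2 * s ^ 2))).const_mul (a * s ^ 2)).neg.deriv⟩

theorem pd_two_connection {a : ℝ} {M : ℝ → ℝ} {x : Coord} (hr : 0 < x 1) :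
    let r := x 1
    let s := sin (x 2)
    let c := cos (x 2)
    let R := rhoSq a x
    let w' := 2 * M (x 0) * r * (R * (c ^ 2 - s ^ 2) + 6 * a ^ 2 * c ^ 2 * s ^ 2) / R ^ 4
    pd 2 (fun y => connection a M y 2 0 0) x = -(a ^ 2 * w') ∧
    pd 2 (fun y => connection a M y 2 3 0) x = a * Gam a x * w' := by
  intro r s c R w'
  have hR0 : R ≠ 0 := rhoSq_ne_zero hr
  have hR : HasDerivAt (fun t => r ^ 2 + a ^ 2 * cos t ^ 2) (-(2 * a ^ 2 * c * s)) (x 2) :=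
    hasDerivAt_polar _ _ _
  have hw (k : ℝ) : HasDerivAt (fun t => k * (2 * M (x 0) * r * cos t * sin t /
      (r ^ 2 + a ^ 2 * cos t ^ 2) ^ 2) / (r ^ 2 + a ^ 2 * cos t ^ 2)) (k * w') (x 2) := by
    refine ((((((hasDerivAt_cos (x 2)).const_mul (2 * M (x 0) * r)).mul (hasDerivAt_sin (x 2))).div
      (hR.pow 2) (pow_ne_zero 2 hR0)).const_mul k).div hR hR0).congr_deriv ?_
    simp only [w', Pi.div_apply, Pi.mul_apply, Pi.pow_apply,
      show r ^ 2 + a ^ 2 * cos (x 2) ^ 2 = R from rfl, c, s]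
    field_simp
    push_cast
    ring
  exact ⟨(hw (a ^ 2)).neg.deriv, (hw (a * Gam a x)).deriv⟩

theorem pd_three_connection (a : ℝ) (M : ℝ → ℝ) (x : Coord) (α β γ : Fin 4) :
    pd 3 (fun y => connection a M y α β γ) x = 0 :=
  deriv_const (x 3) (connection a M x α β γ)

theorem pd_zero_connection_two_two (a : ℝ) (M : ℝ → ℝ) (x : Coord) (β : Fin 4) :
    pd 0 (fun y => connection a M y 2 β 2) x = 0 := by
  fin_cases β <;>
    simp only [pd, connection, rhoSq, Matrix.of_apply, Matrix.cons_val, Fin.zero_eta, Fin.mk_one,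
      Fin.reduceFinMk] <;>
    simp

/-- Of the eight derivative terms four survive: the two with $\alpha=v$ cancel, nothing depends on
$\psi$, and $\Gamma^\vartheta{}_{\beta\vartheta}$ does not involve $v$. -/
theorem ricci_metric_eq {a : ℝ} {M : ℝ → ℝ} {x : Coord} (hr : 0 < x 1) (hs : sin (x 2) ≠ 0)
    (β : Fin 4) :
    ricci (metric a M) β 0 x =
      pd 1 (fun y => connection a M y 1 β 0) x + pd 2 (fun y => connection a M y 2 β 0) x
        - pd 0 (fun y => connection a M y 1 β 1) x - pd 0 (fun y => connection a M y 3 β 3) x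
        + ∑ α, ∑ δ, (connection a M x α α δ * connection a M x δ β 0
          - connection a M x α 0 δ * connection a M x δ β α) := by
  simp only [ricci, pd_christoffel hr hs, christoffel_metric hr hs]
  rw [Fin.sum_univ_four, pd_three_connection, pd_zero_connection_two_two]
  ring

theorem ricci_zero_zero {a : ℝ} {M : ℝ → ℝ} (hM : ContDiff ℝ 2 M) {x : Coord} (hr : 0 < x 1)
    (hs : sin (x 2) ≠ 0) :
    ricci (metric a M) 0 0 x =
      2 * deriv M (x 0) * (x 1 ^ 2 * rhoSq a x + a ^ 2 * sin (x 2) ^ 2 *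
        (x 1 ^ 2 - a ^ 2 * cos (x 2) ^ 2)) / rhoSq a x ^ 3 -
      deriv (deriv M) (x 0) * x 1 * a ^ 2 * sin (x 2) ^ 2 / rhoSq a x ^ 2 := by
  have hR := rhoSq_ne_zero (a := a) hr
  rw [ricci_metric_eq hr hs, (pd_one_connection hr).1, (pd_two_connection hr).1,
    (pd_zero_connection hM x).1, (pd_zero_connection hM x).2.1]
  simp only [Fin.sum_univ_four, connection, Matrix.of_apply, Matrix.cons_val, zero_mul, mul_zero,
    add_zero, sub_zero, zero_sub, mul_neg, neg_mul, neg_neg]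
  field_simp
  simp only [rhoSq, Gam, Delta, cos_sq']
  ring

theorem ricci_one_zero {a : ℝ} {M : ℝ → ℝ} {x : Coord} (hr : 0 < x 1)
    (hs : sin (x 2) ≠ 0) :
    ricci (metric a M) 1 0 x = 0 := by
  have hR := rhoSq_ne_zero (a := a) hr
  have h2 : pd 2 (fun y => connection a M y 2 1 0) x = 0 := by
    simp only [pd, connection, Matrix.of_apply, Matrix.cons_val, deriv_const]
  have h1 : pd 0 (fun y => connection a M y 1 1 1) x = 0 := by
    simp only [pd, connection, Matrix.of_apply, Matrix.cons_val, deriv_const]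
  have h3 : pd 0 (fun y => connection a M y 3 1 3) x = 0 := by
    simp only [pd, connection, rhoSq, Matrix.of_apply, Matrix.cons_val]
    simp
  rw [ricci_metric_eq hr hs, (pd_one_connection hr).2.1, h1, h2, h3]
  simp only [Fin.sum_univ_four, connection, Matrix.of_apply, Matrix.cons_val, zero_mul, mul_zero,
    add_zero, sub_zero, zero_sub, mul_neg, neg_mul, neg_neg]
  field_simp
  simp only [rhoSq, Gam, cos_sq']
  ring

theorem ricci_three_zero {a : ℝ} {M : ℝ → ℝ} (hM : ContDiff ℝ 2 M) {x : Coord} (hr : 0 < x 1)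
    (hs : sin (x 2) ≠ 0) :
    ricci (metric a M) 3 0 x =
      -(a * sin (x 2) ^ 2 * (ricci (metric a M) 0 0 x +
        deriv M (x 0) * (x 1 ^ 2 - a ^ 2 * cos (x 2) ^ 2) / rhoSq a x ^ 2)) := by
  have hR := rhoSq_ne_zero (a := a) hr
  rw [ricci_zero_zero hM hr hs, ricci_metric_eq hr hs, (pd_one_connection hr).2.2,
    (pd_two_connection hr).2, (pd_zero_connection hM x).2.2.1, (pd_zero_connection hM x).2.2.2]
  simp only [Fin.sum_univ_four, connection, Matrix.of_apply, Matrix.cons_val, zero_mul, mul_zero,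
    sub_zero, mul_neg, neg_mul, neg_neg]
  field_simp
  simp only [rhoSq, Gam, Delta, cos_sq']
  ring

/-- Because $r^2+a^2-a^2\sin^2\vartheta=\rho^2$, the multiples of $R_{vv}$ in
$g^{rv}R_{vv}+g^{r\psi}R_{\psi v}$ add up to exactly $R_{vv}$. -/
theorem current_kodamaField_eq {a : ℝ} {M : ℝ → ℝ} (hM : ContDiff ℝ 2 M) {x : Coord}
    (hr : 0 < x 1) (hs : sin (x 2) ≠ 0) :
    current (metric a M) kodamaField 1 x =
      deriv M (x 0) * (2 * x 1 ^ 2 * rhoSq a x + a ^ 2 * sin (x 2) ^ 2 *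
        (x 1 ^ 2 - a ^ 2 * cos (x 2) ^ 2)) / rhoSq a x ^ 3 -
      deriv (deriv M) (x 0) * x 1 * a ^ 2 * sin (x 2) ^ 2 / rhoSq a x ^ 2 := by
  have hR := rhoSq_ne_zero (a := a) hr
  rw [current_kodamaField hr hs, Fin.sum_univ_four, ricci_one_zero hr hs,
    ricci_three_zero hM hr hs, ricci_zero_zero hM hr hs]
  simp only [inverseMetric, Matrix.of_apply, Matrix.cons_val, zero_mul, mul_zero, add_zero]
  field_simp
  simp only [rhoSq, Gam, cos_sq']
  ring

/-! ### Charge density and its polar integrals -/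

/-- The polar profile multiplying `M'` in the charge density. -/
noncomputable def massProfile (a r θ : ℝ) : ℝ :=
  sin θ * (2 * r ^ 2 * (r ^ 2 + a ^ 2 * cos θ ^ 2) + a ^ 2 * sin θ ^ 2 *
    (r ^ 2 - a ^ 2 * cos θ ^ 2)) / (r ^ 2 + a ^ 2 * cos θ ^ 2) ^ 2

/-- The polar profile multiplying `-M''` in the charge density. -/
noncomputable def fluxProfile (a r θ : ℝ) : ℝ :=
  r * a ^ 2 * sin θ ^ 3 / (r ^ 2 + a ^ 2 * cos θ ^ 2)

theorem measurableSet_sigma (v : ℝ) : MeasurableSet (sigma v) :=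
  measurableSet_Iic.prod (measurableSet_Ioo.prod measurableSet_Ioo)

theorem chargeDensity_eq {a : ℝ} {M : ℝ → ℝ} (hM : ContDiff ℝ 2 M) {r v : ℝ} (hr : 0 < r)
    {p : ℝ × ℝ × ℝ} (hp : p ∈ sigma v) :
    chargeDensity a M r p =
      deriv M p.1 * massProfile a r p.2.1 - deriv (deriv M) p.1 * fluxProfile a r p.2.1 := by
  have hs : 0 < sin (embed r p 2) := sin_pos_of_mem_Ioo hp.2.1
  have hr' : 0 < embed r p 1 := hr
  have hR : 0 < rhoSq a (embed r p) := by unfold rhoSq; positivity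
  have hdet : √(-(metric a M (embed r p)).det) = rhoSq a (embed r p) * sin (embed r p 2) := by
    rw [det_metric hr', neg_neg, sqrt_sq (by positivity)]
  rw [chargeDensity, hdet, Fin.sum_univ_four]
  simp only [normalCovector, Matrix.cons_val, mul_zero, mul_one, zero_add, add_zero]
  rw [current_kodamaField_eq hM hr' hs.ne']
  have h : rhoSq a (embed r p) = r ^ 2 + a ^ 2 * cos p.2.1 ^ 2 := rfl
  have h0 : embed r p 0 = p.1 := rfl
  have h1 : embed r p 1 = r := rfl
  have h2 : embed r p 2 = p.2.1 := rfl
  rw [h] at hR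
  rw [massProfile, fluxProfile, h, h0, h1, h2]
  field_simp

theorem continuous_massProfile (a : ℝ) {r : ℝ} (hr : 0 < r) : Continuous (massProfile a r) := by
  unfold massProfile
  exact Continuous.div (by fun_prop) (by fun_prop) fun θ => by positivity

theorem continuous_fluxProfile (a : ℝ) {r : ℝ} (hr : 0 < r) : Continuous (fluxProfile a r) := by
  unfold fluxProfile
  exact Continuous.div (by fun_prop) (by fun_prop) fun θ => by positivity

theorem integral_Ioo_eq_sub {f F : ℝ → ℝ} (hf : Continuous f) (hF : ∀ x, HasDerivAt F (f x) x)
    {b c : ℝ} (hbc : b ≤ c) : ∫ x in Ioo b c, f x = F c - F b := by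
  rw [← integral_Ioc_eq_integral_Ioo, ← intervalIntegral.integral_of_le hbc]
  exact intervalIntegral.integral_eq_sub_of_hasDerivAt (fun x _ => hF x) (hf.intervalIntegrable _ _)

theorem integral_massProfile (a : ℝ) {r : ℝ} (hr : 0 < r) :
    ∫ θ in Ioo 0 π, massProfile a r θ = 4 := by
  -- The second term of the primitive vanishes at both poles, so neither $a$ nor $r$ affects the
  -- integral.
  have hF (θ : ℝ) : HasDerivAt (fun t => -(2 * cos t) - a ^ 2 * cos t * sin t ^ 2 /
      (r ^ 2 + a ^ 2 * cos t ^ 2)) (massProfile a r θ) θ := by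
    have hR : r ^ 2 + a ^ 2 * cos θ ^ 2 ≠ 0 := by positivity
    refine (((hasDerivAt_cos θ).const_mul 2).neg.sub ((((hasDerivAt_cos θ).const_mul (a ^ 2)).mul
      (hasDerivAt_sin_sq θ)).div (hasDerivAt_polar a (r ^ 2) θ) hR)).congr_deriv ?_
    simp only [massProfile, Pi.mul_apply]
    field_simp
    simp only [sin_sq]
    ring
  rw [integral_Ioo_eq_sub (continuous_massProfile a hr) hF pi_pos.le]
  norm_num

theorem integral_fluxProfile {a : ℝ} (ha : a ≠ 0) {r : ℝ} (hr : 0 < r) :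
    ∫ θ in Ioo 0 π, fluxProfile a r θ = 2 * ((r ^ 2 + a ^ 2) / a * arctan (a / r) - r) := by
  -- Primitive from $u=\cos\vartheta$ and $a^2(1-u^2)=(r^2+a^2)-(r^2+a^2u^2)$.
  have hF (θ : ℝ) : HasDerivAt (fun t => r * cos t - (r ^ 2 + a ^ 2) / a * arctan (a / r * cos t))
      (fluxProfile a r θ) θ := by
    have hR : r ^ 2 + a ^ 2 * cos θ ^ 2 ≠ 0 := by positivity
    refine (((hasDerivAt_cos θ).const_mul r).sub
      (((hasDerivAt_cos θ).const_mul (a / r)).arctan.const_mul ((r ^ 2 + a ^ 2) / a))).congr_deriv ?_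
    have h : 1 + (a / r * cos θ) ^ 2 = (r ^ 2 + a ^ 2 * cos θ ^ 2) / r ^ 2 := by field_simp
    rw [h, fluxProfile]
    field_simp
    simp only [cos_sq']
    ring
  rw [integral_Ioo_eq_sub (continuous_fluxProfile a hr) hF pi_pos.le]
  simp only [cos_pi, cos_zero, mul_neg, mul_one, arctan_neg]
  ring

theorem fluxProfile_zero (r θ : ℝ) : fluxProfile 0 r θ = 0 := by simp [fluxProfile]

theorem abs_fluxProfile_le (a : ℝ) {r : ℝ} (hr : 0 < r) (θ : ℝ) :
    |fluxProfile a r θ| ≤ a ^ 2 / r := by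
  have h : |sin θ ^ 3| ≤ 1 := by
    rw [abs_pow]; exact pow_le_one₀ (abs_nonneg _) (abs_sin_le_one θ)
  have hR : r ^ 2 ≤ r ^ 2 + a ^ 2 * cos θ ^ 2 := by nlinarith [mul_self_nonneg (a * cos θ)]
  rw [fluxProfile, abs_div, abs_mul, abs_of_pos (by positivity : 0 < r ^ 2 + a ^ 2 * cos θ ^ 2),
    abs_of_nonneg (by positivity : 0 ≤ r * a ^ 2)]
  calc r * a ^ 2 * |sin θ ^ 3| / (r ^ 2 + a ^ 2 * cos θ ^ 2) ≤ r * a ^ 2 * 1 / r ^ 2 := by gcongr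
    _ = a ^ 2 / r := by field_simp

theorem tendsto_integral_fluxProfile (a : ℝ) :
    Tendsto (fun r => ∫ θ in Ioo 0 π, fluxProfile a r θ) atTop (𝓝 0) := by
  have h : Tendsto (fun r : ℝ => a ^ 2 / r * (volume : Measure ℝ).real (Ioo 0 π)) atTop (𝓝 0) := by
    have h := (tendsto_const_nhds (x := a ^ 2)).div_atTop (tendsto_id (α := ℝ) (x := atTop))
    simpa using h.mul_const ((volume : Measure ℝ).real (Ioo 0 π))
  refine squeeze_zero_norm' ?_ h
  filter_upwards [eventually_gt_atTop 0] with r hr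
  exact norm_setIntegral_le_of_norm_le_const (by simp) fun θ _ => abs_fluxProfile_le a hr θ

/-! ### Integration over the hypersurface and the charge -/

theorem integrableOn_sigma {m f : ℝ → ℝ} {v : ℝ} (hm : IntegrableOn m (Iic v))
    (hf : Continuous f) : IntegrableOn (fun p : ℝ × ℝ × ℝ => m p.1 * f p.2.1) (sigma v) := by
  have hf' : IntegrableOn f (Ioo 0 π) :=
    (hf.integrableOn_Icc (a := 0) (b := π)).mono_set Ioo_subset_Icc_self
  have h1 : IntegrableOn (fun _ : ℝ => (1 : ℝ)) (Ioo 0 (2 * π)) :=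
    integrableOn_const measure_Ioo_lt_top.ne
  have h := hm.mul_prod (hf'.mul_prod h1)
  rw [Measure.prod_restrict, Measure.prod_restrict] at h
  simp only [mul_one] at h
  exact h

theorem integral_sigma (m f : ℝ → ℝ) (v : ℝ) :
    ∫ p in sigma v, m p.1 * f p.2.1 =
      (∫ t in Iic v, m t) * ((∫ θ in Ioo 0 π, f θ) * (2 * π)) := by
  have h1 := setIntegral_prod_mul (μ := volume) (ν := volume) f (fun _ : ℝ => (1 : ℝ)) (Ioo 0 π)
    (Ioo 0 (2 * π))
  have h2 := setIntegral_prod_mul (μ := volume) (ν := volume) m (fun q : ℝ × ℝ => f q.1 * 1)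
    (Iic v) (Ioo 0 π ×ˢ Ioo 0 (2 * π))
  rw [← Measure.volume_eq_prod] at h1
  rw [h1, ← Measure.volume_eq_prod] at h2
  have h3 : ∫ _ in Ioo 0 (2 * π), (1 : ℝ) = 2 * π := by simp [pi_pos.le]
  simp only [mul_one, h3] at h2
  exact h2

theorem integrableOn_chargeDensity {a : ℝ} {M : ℝ → ℝ} (hM : ContDiff ℝ 2 M) {r v : ℝ} (hr : 0 < r)
    (hM1 : IntegrableOn (deriv M) (Iic v)) (hM2 : IntegrableOn (deriv (deriv M)) (Iic v)) :
    IntegrableOn (chargeDensity a M r) (sigma v) :=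
  ((integrableOn_sigma hM1 (continuous_massProfile a hr)).sub
    (integrableOn_sigma hM2 (continuous_fluxProfile a hr))).congr_fun
    (fun _ hp => (chargeDensity_eq hM hr hp).symm)
    (measurableSet_sigma v)

theorem charge_eq {a : ℝ} {M : ℝ → ℝ} (hM : ContDiff ℝ 2 M) {r v : ℝ} (hr : 0 < r)
    (hM0 : Tendsto M atBot (𝓝 0))
    (hM1 : IntegrableOn (deriv M) (Iic v)) (hM2 : IntegrableOn (deriv (deriv M)) (Iic v)) :
    charge a M r v = M v - deriv M v * ((∫ θ in Ioo 0 π, fluxProfile a r θ) / 4) := by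
  have hd1 (t : ℝ) : HasDerivAt M (deriv M t) t := (hM.differentiable (by norm_num) t).hasDerivAt
  have hd2 (t : ℝ) : HasDerivAt (deriv M) (deriv (deriv M) t) t :=
    (((contDiff_succ_iff_deriv (n := 1)).1 hM).2.2.differentiable (by norm_num) t).hasDerivAt
  have hlim : Tendsto (deriv M) atBot (𝓝 0) :=
    tendsto_zero_of_hasDerivAt_of_integrableOn_Iic (fun t _ => hd2 t) hM2 hM1
  rw [charge, setIntegral_congr_fun (measurableSet_sigma v)
      (fun _ hp => chargeDensity_eq hM hr hp),
    integral_sub (integrableOn_sigma hM1 (continuous_massProfile a hr))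
      (integrableOn_sigma hM2 (continuous_fluxProfile a hr)),
    integral_sigma, integral_sigma, integral_massProfile a hr,
    integral_Iic_of_hasDerivAt_of_tendsto' (fun t _ => hd1 t) hM1 hM0,
    integral_Iic_of_hasDerivAt_of_tendsto' (fun t _ => hd2 t) hM2 hlim]
  -- The constants are $4\cdot2\pi/(8\pi)=1$ for the mass term and $2\pi/(8\pi)=1/4$ for the flux
  -- term.
  field_simp
  ring

end KerrVaidya

theorem proposition3 (a : ℝ) (M : ℝ → ℝ) (hM : ContDiff ℝ 2 M)
    (hM0 : Tendsto M atBot (𝓝 0)) (v : ℝ)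
    (hM1 : IntegrableOn (deriv M) (Iic v)) (hM2 : IntegrableOn (deriv (deriv M)) (Iic v)) :
    (∀ r : ℝ, 0 < r →
      IntegrableOn (KerrVaidya.chargeDensity a M r) (KerrVaidya.sigma v) ∧
      (a ≠ 0 → KerrVaidya.charge a M r v =
        M v - deriv M v * ((r ^ 2 + a ^ 2) / (2 * a) * arctan (a / r) - r / 2)) ∧
      (a = 0 → KerrVaidya.charge a M r v = M v)) ∧
    Tendsto (fun r : ℝ => KerrVaidya.charge a M r v) atTop (𝓝 (M v)) := by
  refine ⟨fun r hr => ⟨KerrVaidya.integrableOn_chargeDensity hM hr hM1 hM2, fun ha => ?_,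
    fun ha => ?_⟩, ?_⟩
  · rw [KerrVaidya.charge_eq hM hr hM0 hM1 hM2, KerrVaidya.integral_fluxProfile ha hr]
    field_simp
    ring
  · subst ha
    simp [KerrVaidya.charge_eq hM hr hM0 hM1 hM2, KerrVaidya.fluxProfile_zero]
  · have h := (((KerrVaidya.tendsto_integral_fluxProfile a).div_const 4).const_mul
      (deriv M v)).const_sub (M v)
    simp only [zero_div, mul_zero, sub_zero] at h
    refine h.congr' ?_
    filter_upwards [eventually_gt_atTop 0] with r hr
    exact (KerrVaidya.charge_eq hM hr hM0 hM1 hM2).symm
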